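/- For a finite simple graph $G$ with vertex set $V(G)$, a Lipschitz function on $G$ is a function $f:V(G)\to\mathbb{R}$ with $|f(v)-f(w)|\le 1$ for every pair of adjacent vertices $v,w$; $\operatorname{Var}(f)$ denotes the variance of $f(X)$ for $X$ uniformly distributed on $V(G)$, and the spread of $G$ is $\operatorname{spr}(G)=\sup_f \operatorname{Var}(f)\in[0,\infty]$, the supremum being over all Lipschitz functions $f$ on $G$ (it is infinite if $G$ is disconnected, and it is an attained, finite maximum if $G$ is connected). Let $G_{n,d}$ be a uniformly random $d$-regular simple graph on $n$ labelled vertices, where $n$ is required to be even if $d$ is odd. There is an absolute constant $C>0$ such that, for every fixed integer $d\ge 3$, $\operatorname{spr}(G_{n,d})\le C$ with high probability, that is, $$\mathbb{P}\bigl(\operatorname{spr}(G_{n,d})\le C\bigr)\to 1\qquad\text{as } n\to\infty \text{ with } dn \text{ even}.$$ Equivalently, with high probability every Lipschitz function $f$ on $G_{n,d}$ satisfies $\operatorname{Var}(f)\le C$. -/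

import Mathlib

open Filter Topology
open scoped ENNReal

noncomputable section

namespace SimpleGraph

/-- A Lipschitz function on a graph: a real function on the vertex set that changes by at most `1`
along every edge. -/
def IsLipschitzFun {V : Type*} (G : SimpleGraph V) (f : V → ℝ) : Prop :=
  ∀ v w : V, G.Adj v w → |f v - f w| ≤ 1

end SimpleGraph

/-- The mean of `f` at a uniformly distributed point of the finite set `V`. -/
def uniformMean {V : Type*} [Fintype V] (f : V → ℝ) : ℝ :=
  (∑ v, f v) / (Fintype.card V : ℝ)

/-- The variance of `f` at a uniformly distributed point of the finite set `V`. -/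
def uniformVariance {V : Type*} [Fintype V] (f : V → ℝ) : ℝ :=
  uniformMean (fun v => (f v - uniformMean f) ^ 2)

/-- The spread of a finite graph: the supremum of the variances of its Lipschitz functions at a
uniformly distributed vertex. It is taken in `[0, ∞]`, so it is `∞` if the variances are
unbounded, as they are for a disconnected graph. -/
def SimpleGraph.spread {V : Type*} [Fintype V] (G : SimpleGraph V) : ℝ≥0∞ :=
  ⨆ (f : V → ℝ) (_ : G.IsLipschitzFun f), ENNReal.ofReal (uniformVariance f)

open scoped Classical in
/-- The set of `d`-regular simple graphs on the labelled vertex set `{0, …, n - 1}`. -/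
def regularGraphs (n d : ℕ) : Set (SimpleGraph (Fin n)) :=
  {G | G.IsRegularOfDegree d}

/-- The probability that the random regular graph `G_{n,d}`, uniformly distributed on
`regularGraphs n d`, has the property `P`. -/
def randomRegularProb (n d : ℕ) (P : SimpleGraph (Fin n) → Prop) : ℝ :=
  ({G ∈ regularGraphs n d | P G}.ncard : ℝ) / ((regularGraphs n d).ncard : ℝ)

/-- The random regular graph `G_{n,d}` has the property `P` with high probability: the probability
tends to `1` as `n → ∞` through the integers for which `d * n` is even (that is, through the even
integers if `d` is odd, and through all integers if `d` is even). -/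
def RandomRegularWhp (d : ℕ) (P : ∀ n : ℕ, SimpleGraph (Fin n) → Prop) : Prop :=
  Tendsto (fun n : ℕ => randomRegularProb n d (P n)) (atTop ⊓ 𝓟 {n : ℕ | Even (d * n)}) (𝓝 1)

end

/-!
A random `d`-regular graph is, with high probability, a vertex expander with a constant that does
not depend on `d`, and vertex expanders have bounded spread.

*Expansion bounds the spread.* Suppose that every set `S` of at most half of the vertices has at
least `|S| / K` outer neighbours. If `m` is a median of a Lipschitz function `f`, then all
neighbours of the level set `{f > m + t + 1}` lie in `{f > m + t}`, so the sizes of these level sets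
decay geometrically in `t`, and so do those below the median. Hence the mean of `(f - m) ^ 2`, which
is at least the variance, is bounded by a constant depending on `K` only
(`SimpleGraph.IsVertexExpander.spread_le`).

*Random regular graphs expand.* If a set `S` of size `s` has fewer than `s / 60` outer neighbours,
then `S` spans at least `k = ⌈59 d s / 120⌉` edges. The number of edges spanned by `S` is controlled
by its factorial moments over all `d`-regular graphs. Instead of the configuration model, which
would need a lower bound for the probability of being simple, a switching is used directly on simple
graphs: an edge `uv` inside `S` and another edge `xy` are replaced by `ux` and `vy`. Counting these
switchings from both sides gives a recursion for the moments (`edgeMoment_succ_le`), whose solution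
is the bound `choose (d s) (2 k) / choose M k` with `M = d n / 2 - d (d + 1)` for the probability
that `S` spans at least `k` edges (`edgeMoment_mul_choose_le`).

*The union bound.* By Vandermonde's identity, `choose M k` is at least
`choose n s * choose (M - n) (k - s)`. The first factor pays for the choice of `S`; since
`s ≤ n / 2`, the second one is at least of order `2 ^ (k - s) * n / (d s)`, and `2 ^ (k - s)` beats
`choose (d s) (2 k)` because `d s - 2 k` is a small proportion of `d s`. The resulting bounds sum to
`O(1 / n)` over `s` (`card_not_expander_le`). Finally, regular graphs exist
(`regularFinset_fin_nonempty`), so that the probabilities are not quotients by zero.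
-/

/-! ### Switchings of regular graphs -/

section Switching

variable {V : Type*}

/-- The graph obtained from `G` by replacing the edges `uv` and `xy` by `ux` and `vy`. -/
def SimpleGraph.switch (G : SimpleGraph V) (u v x y : V) : SimpleGraph V :=
  (G \ SimpleGraph.fromEdgeSet {s(u, v), s(x, y)}) ⊔ SimpleGraph.fromEdgeSet {s(u, x), s(v, y)}

/-- The edges `uv` and `xy` of `G` may be replaced by `ux` and `vy`: the new pairs are not loops
and not already edges. -/
structure SimpleGraph.Switchable (G : SimpleGraph V) (u v x y : V) : Prop where
  adj₁ : G.Adj u v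
  adj₂ : G.Adj x y
  ne₁ : u ≠ x
  ne₂ : v ≠ y
  not_adj₁ : ¬ G.Adj u x
  not_adj₂ : ¬ G.Adj v y

namespace SimpleGraph.Switchable

variable {G : SimpleGraph V} {u v x y : V}

theorem ne₃ (h : G.Switchable u v x y) : u ≠ y := by
  rintro rfl; exact h.not_adj₁ h.adj₂.symm

theorem ne₄ (h : G.Switchable u v x y) : v ≠ x := by
  rintro rfl; exact h.not_adj₁ h.adj₁

theorem switch_adj (h : G.Switchable u v x y) (a b : V) :
    (G.switch u v x y).Adj a b ↔
      (G.Adj a b ∧ ¬ (a = u ∧ b = v ∨ a = v ∧ b = u) ∧ ¬ (a = x ∧ b = y ∨ a = y ∧ b = x)) ∨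
        (a = u ∧ b = x ∨ a = x ∧ b = u) ∨ (a = v ∧ b = y ∨ a = y ∧ b = v) := by
  have h1 := h.ne₁
  have h2 := h.ne₂
  simp only [SimpleGraph.switch, SimpleGraph.sup_adj, SimpleGraph.sdiff_adj,
    SimpleGraph.fromEdgeSet_adj, Set.mem_insert_iff, Set.mem_singleton_iff, Sym2.eq_iff]
  constructor
  · rintro (⟨hab, hn⟩ | ⟨hab, -⟩)
    · have := hab.ne
      tauto
    · exact Or.inr hab
  · rintro (⟨hab, hn⟩ | hab)
    · tauto
    · refine Or.inr ⟨hab, ?_⟩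
      rintro rfl
      grind

/-- Switching back `ux` and `vy` to `uv` and `xy` recovers the original graph. -/
theorem switch_switch (h : G.Switchable u v x y) :
    (G.switch u v x y).switch u x v y = G := by
  have h' : (G.switch u v x y).Switchable u x v y := by
    have := h.ne₁; have := h.ne₂; have := h.ne₃; have := h.ne₄
    have := h.adj₁.ne; have := h.adj₂.ne
    refine ⟨?_, ?_, ?_, ?_, ?_, ?_⟩ <;> (try simp only [h.switch_adj]) <;> grind
  ext a b
  have e1 := h.adj₁
  have e2 := h.adj₂
  have e3 := h.not_adj₁
  have e4 := h.not_adj₂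
  have e5 := h.adj₁.symm
  have e6 := h.adj₂.symm
  have e7 : ¬ G.Adj x u := fun h' => e3 h'.symm
  have e8 : ¬ G.Adj y v := fun h' => e4 h'.symm
  have := h.ne₁; have := h.ne₂; have := h.ne₃; have := h.ne₄
  have := h.adj₁.ne; have := h.adj₂.ne
  simp only [h'.switch_adj, h.switch_adj]
  grind (splits := 30)

open scoped Classical in
/-- A switching does not change the degrees. -/
theorem card_switch [Fintype V] (h : G.Switchable u v x y) (w : V) :
    (Finset.univ.filter ((G.switch u v x y).Adj w)).card =
      (Finset.univ.filter (G.Adj w)).card := by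
  have key : ∀ p q : V, G.Adj w p → ¬ G.Adj w q →
      (insert q ((Finset.univ.filter (G.Adj w)).erase p)).card =
        (Finset.univ.filter (G.Adj w)).card := by
    intro p q hp hq
    rw [Finset.card_insert_of_notMem (by simp [hq]), Finset.card_erase_add_one (by simp [hp])]
  have e1 := h.adj₁
  have e2 := h.adj₂
  have e3 := h.not_adj₁
  have e4 := h.not_adj₂
  have e5 := h.adj₁.symm
  have e6 := h.adj₂.symm
  have e7 : ¬ G.Adj x u := fun h' => e3 h'.symm
  have e8 : ¬ G.Adj y v := fun h' => e4 h'.symm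
  have := h.ne₁; have := h.ne₂; have := h.ne₃; have := h.ne₄
  have := h.adj₁.ne; have := h.adj₂.ne
  by_cases hu : w = u
  · subst hu
    rw [← key v x e1 e3]; congr 1; ext z
    simp only [Finset.mem_filter, Finset.mem_univ, true_and, Finset.mem_insert, Finset.mem_erase,
      h.switch_adj]
    grind
  by_cases hv : w = v
  · subst hv
    rw [← key u y e5 e4]; congr 1; ext z
    simp only [Finset.mem_filter, Finset.mem_univ, true_and, Finset.mem_insert, Finset.mem_erase,
      h.switch_adj]
    grind
  by_cases hx : w = x
  · subst hx
    rw [← key y u e2 e7]; congr 1; ext z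
    simp only [Finset.mem_filter, Finset.mem_univ, true_and, Finset.mem_insert, Finset.mem_erase,
      h.switch_adj]
    grind
  by_cases hy : w = y
  · subst hy
    rw [← key x v e6 e8]; congr 1; ext z
    simp only [Finset.mem_filter, Finset.mem_univ, true_and, Finset.mem_insert, Finset.mem_erase,
      h.switch_adj]
    grind
  congr 1; ext z
  simp only [Finset.mem_filter, Finset.mem_univ, true_and, h.switch_adj]
  grind

end SimpleGraph.Switchable

end Switching

/-! ### Factorial moments of the number of edges inside a vertex set -/

section FactorialMoments

open Finset

open scoped Classical

variable {V : Type*} [Fintype V]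

/-- The `d`-regular graphs on `V`, as a finite set. -/
noncomputable def regularFinset (V : Type*) [Fintype V] (d : ℕ) : Finset (SimpleGraph V) :=
  {G | ∀ v, #{w | G.Adj v w} = d}

/-- The edges of `G` with both endpoints in `S`. -/
noncomputable def SimpleGraph.edgesWithin (G : SimpleGraph V) (S : Finset V) : Finset (Sym2 V) :=
  {e | e ∈ G.edgeSet ∧ ∀ v ∈ e, v ∈ S}

theorem mem_regularFinset {d : ℕ} {G : SimpleGraph V} :
    G ∈ regularFinset V d ↔ ∀ v, #{w | G.Adj v w} = d := by
  simp [regularFinset]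

theorem SimpleGraph.mem_edgesWithin {G : SimpleGraph V} {S : Finset V} {u v : V} :
    s(u, v) ∈ G.edgesWithin S ↔ G.Adj u v ∧ u ∈ S ∧ v ∈ S := by
  simp [SimpleGraph.edgesWithin]

/-- A set of unordered pairs without loops is covered twice by ordered pairs. -/
theorem card_orderedPairs (E : Finset (Sym2 V)) (hE : ∀ e ∈ E, ¬ e.IsDiag) :
    #{p : V × V | s(p.1, p.2) ∈ E} = 2 * #E := by
  rw [Finset.card_eq_sum_card_fiberwise (f := fun p : V × V => s(p.1, p.2)) (t := E)
    (fun p hp => by simpa using hp)]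
  rw [mul_comm, ← smul_eq_mul, ← Finset.sum_const]
  refine Finset.sum_congr rfl fun e he => ?_
  induction e with
  | h a b =>
    have hab : a ≠ b := by simpa using hE _ he
    have : ({p ∈ ({p : V × V | s(p.1, p.2) ∈ E} : Finset (V × V)) | s(p.1, p.2) = s(a, b)}) =
        {(a, b), (b, a)} := by
      ext ⟨p, q⟩
      simp only [mem_filter, mem_univ, true_and, mem_insert, mem_singleton, Prod.mk.injEq,
        Sym2.eq_iff]
      constructor
      · rintro ⟨-, h⟩; exact h
      · rintro (⟨rfl, rfl⟩ | ⟨rfl, rfl⟩)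
        · exact ⟨he, by simp⟩
        · exact ⟨by rwa [Sym2.eq_swap], by simp⟩
    rw [this, card_pair]
    simp [hab]

/-- Summing the degrees over `S`. -/
theorem card_darts {d : ℕ} {G : SimpleGraph V} (hG : G ∈ regularFinset V d) (S : Finset V) :
    #{p : V × V | G.Adj p.1 p.2 ∧ p.1 ∈ S} = d * #S := by
  rw [mem_regularFinset] at hG
  rw [Finset.card_eq_sum_card_fiberwise (f := Prod.fst) (t := S) (fun p hp => by simp at hp; simp [hp])]
  rw [mul_comm, ← smul_eq_mul, ← Finset.sum_const]
  refine Finset.sum_congr rfl fun v hv => ?_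
  rw [← hG v]
  refine Finset.card_bij' (fun p _ => p.2) (fun w _ => (v, w)) ?_ ?_ ?_ ?_
  · rintro ⟨a, b⟩; simp; rintro h - rfl; exact h
  · intro w; simp; intro h; exact ⟨h, hv⟩
  · rintro ⟨a, b⟩; simp; rintro _ _ rfl; rfl
  · intros; rfl

/-- For an edge `uv`, all but at most `2 #E + 2 d (d + 1)` of the `d n` ordered edges `xy` avoid `E` and
can be switched with `uv`. -/
theorem le_card_switchable {d : ℕ} {G : SimpleGraph V} (hG : G ∈ regularFinset V d)
    (E : Finset (Sym2 V)) (hE : ∀ e ∈ E, ¬ e.IsDiag) {u v : V} (huv : G.Adj u v) :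
    d * Fintype.card V - 2 * #E - 2 * d * (d + 1) ≤
      #{p : V × V | G.Switchable u v p.1 p.2 ∧ s(p.1, p.2) ∉ E} := by
  have hn : ∀ z : V, #(insert z ({w | G.Adj z w} : Finset V)) = d + 1 := by
    intro z
    rw [card_insert_of_notMem (by simp), mem_regularFinset.1 hG]
  let A : Finset (V × V) := {p | G.Adj p.1 p.2 ∧ p.1 ∈ insert u ({w | G.Adj u w} : Finset V)}
  let B : Finset (V × V) := {p | G.Adj p.1 p.2 ∧ p.2 ∈ insert v ({w | G.Adj v w} : Finset V)}
  let C : Finset (V × V) := {p | s(p.1, p.2) ∈ E}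
  let D : Finset (V × V) := {p | G.Switchable u v p.1 p.2 ∧ s(p.1, p.2) ∉ E}
  have hA : #A = d * (d + 1) := by rw [← hn u, ← card_darts hG]
  have hB : #B = d * (d + 1) := by
    rw [← hn v, ← card_darts hG]
    refine Finset.card_bij' (fun p _ => p.swap) (fun p _ => p.swap) ?_ ?_ ?_ ?_ <;>
      simp +contextual [B, SimpleGraph.adj_comm]
  have hC : #C = 2 * #E := card_orderedPairs E hE
  have h4 := card_darts hG univ
  have hsub : ({p : V × V | G.Adj p.1 p.2 ∧ p.1 ∈ univ} : Finset (V × V)) ⊆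
      D ∪ (C ∪ (A ∪ B)) := by
    rintro ⟨x, y⟩ hxy
    simp only [A, B, C, D, mem_filter, mem_univ, true_and, and_true, mem_union, mem_insert] at hxy ⊢
    by_contra! hcon
    obtain ⟨c1, c2, c3, c4⟩ := hcon
    exact c2 (c1 ⟨huv, hxy, fun h => (c3 hxy).1 h.symm, fun h => (c4 hxy).1 h.symm,
      (c3 hxy).2, (c4 hxy).2⟩)
  have h5 := card_le_card hsub
  have h6 := card_union_le D (C ∪ (A ∪ B))
  have h7 := card_union_le C (A ∪ B)
  have h8 := card_union_le A B
  rw [card_univ] at h4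
  have e : 2 * d * (d + 1) = d * (d + 1) + d * (d + 1) := by ring
  change _ ≤ #D
  omega

theorem card_darts_within {G : SimpleGraph V} {S : Finset V} :
    #{p : V × V | G.Adj p.1 p.2 ∧ p.1 ∈ S ∧ p.2 ∈ S} = 2 * #(G.edgesWithin S) := by
  rw [← card_orderedPairs (G.edgesWithin S)]
  · congr 1; ext ⟨a, b⟩; simp [SimpleGraph.mem_edgesWithin]
  · intro e he
    simp only [SimpleGraph.edgesWithin, mem_filter] at he
    exact G.not_isDiag_of_mem_edgeSet he.2.1

theorem not_isDiag_of_subset_edgesWithin {G : SimpleGraph V} {S : Finset V} {E : Finset (Sym2 V)}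
    (hE : E ⊆ G.edgesWithin S) : ∀ e ∈ E, ¬ e.IsDiag := fun e he => by
  have := hE he
  simp only [SimpleGraph.edgesWithin, mem_filter] at this
  exact G.not_isDiag_of_mem_edgeSet this.2.1

theorem card_darts_within_sdiff {G : SimpleGraph V} {S : Finset V} {E : Finset (Sym2 V)}
    (hE : E ⊆ G.edgesWithin S) :
    #{p : V × V | G.Adj p.1 p.2 ∧ p.1 ∈ S ∧ p.2 ∈ S ∧ s(p.1, p.2) ∉ E} =
      2 * (#(G.edgesWithin S) - #E) := by
  rw [Nat.mul_sub, ← card_darts_within, ← card_orderedPairs E (not_isDiag_of_subset_edgesWithin hE),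
    ← card_sdiff_of_subset]
  · congr 1; ext ⟨a, b⟩; simp; tauto
  · rintro ⟨a, b⟩ h
    simp at h ⊢
    exact SimpleGraph.mem_edgesWithin.1 (hE h)

theorem card_darts_from_sdiff {d : ℕ} {G : SimpleGraph V} (hG : G ∈ regularFinset V d)
    {S : Finset V} {E : Finset (Sym2 V)} (hE : E ⊆ G.edgesWithin S) :
    #{p : V × V | G.Adj p.1 p.2 ∧ p.1 ∈ S ∧ s(p.1, p.2) ∉ E} = d * #S - 2 * #E := by
  rw [← card_darts hG, ← card_orderedPairs E (not_isDiag_of_subset_edgesWithin hE),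
    ← card_sdiff_of_subset]
  · congr 1; ext ⟨a, b⟩; simp; tauto
  · rintro ⟨a, b⟩ h
    simp at h ⊢
    have := SimpleGraph.mem_edgesWithin.1 (hE h)
    tauto

/-- The switching inequality. The left side is at most the number of ways to switch an edge `uv`
inside `S` with some `xy`, the right side the number of ways to undo this: given the new graph,
one has to name the two distinct ordered edges `ux` and `vy`, which start in `S`. All edges of `E`
are kept. -/
theorem sum_switchings_le (d : ℕ) (S : Finset V) (E : Finset (Sym2 V)) :
    (∑ G ∈ regularFinset V d with E ⊆ G.edgesWithin S,
      2 * (#(G.edgesWithin S) - #E)) * (d * Fintype.card V - 2 * #E - 2 * d * (d + 1)) ≤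
    ∑ G ∈ regularFinset V d with E ⊆ G.edgesWithin S,
      (d * #S - 2 * #E) * (d * #S - 2 * #E - 1) := by
  set R := {G ∈ regularFinset V d | E ⊆ G.edgesWithin S} with hR
  let P : SimpleGraph V → Finset (V × V) :=
    fun G => {p : V × V | G.Adj p.1 p.2 ∧ p.1 ∈ S ∧ p.2 ∈ S ∧ s(p.1, p.2) ∉ E}
  let Q : SimpleGraph V → V × V → Finset (V × V) :=
    fun G p => {q : V × V | G.Switchable p.1 p.2 q.1 q.2 ∧ s(q.1, q.2) ∉ E}
  let D : SimpleGraph V → Finset (V × V) :=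
    fun G => {p : V × V | G.Adj p.1 p.2 ∧ p.1 ∈ S ∧ s(p.1, p.2) ∉ E}
  let src : Finset (Σ _ : SimpleGraph V, Σ _ : V × V, V × V) :=
    R.sigma fun G => (P G).sigma fun p => Q G p
  let tgt : Finset (Σ _ : SimpleGraph V, (V × V) × (V × V)) :=
    R.sigma fun G => (D G).offDiag
  have hsrc : (∑ G ∈ R, 2 * (#(G.edgesWithin S) - #E)) *
      (d * Fintype.card V - 2 * #E - 2 * d * (d + 1)) ≤ #src := by
    rw [card_sigma, sum_mul]
    refine sum_le_sum fun G hG => ?_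
    rw [hR, mem_filter] at hG
    rw [← card_darts_within_sdiff hG.2, card_sigma, ← smul_eq_mul]
    refine card_nsmul_le_sum _ _ _ fun p hp => ?_
    exact le_card_switchable hG.1 E (not_isDiag_of_subset_edgesWithin hG.2) (mem_filter.1 hp).2.1
  have htgt : #tgt = ∑ G ∈ R, (d * #S - 2 * #E) * (d * #S - 2 * #E - 1) := by
    rw [card_sigma]
    refine sum_congr rfl fun G hG => ?_
    rw [hR, mem_filter] at hG
    rw [offDiag_card, card_darts_from_sdiff hG.1 hG.2, Nat.mul_sub_one]
  refine hsrc.trans (htgt ▸ ?_)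
  -- the switching; it is injective because it can be switched back
  refine card_le_card_of_injOn
    (fun t => ⟨t.1.switch t.2.1.1 t.2.1.2 t.2.2.1 t.2.2.2,
      ((t.2.1.1, t.2.2.1), (t.2.1.2, t.2.2.2))⟩) ?_ ?_
  · rintro ⟨G, ⟨u, v⟩, ⟨x, y⟩⟩ h
    simp only [src, tgt, P, Q, D, hR, coe_sigma, Set.mem_sigma_iff, mem_coe, mem_filter, mem_univ,
      true_and, mem_offDiag, ne_eq, Prod.mk.injEq] at h ⊢
    obtain ⟨⟨hG, hE⟩, ⟨huv, hu, hv, huvE⟩, hs, hxyE⟩ := h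
    have huxE : s(u, x) ∉ E := fun h => hs.not_adj₁ (SimpleGraph.mem_edgesWithin.1 (hE h)).1
    have hvyE : s(v, y) ∉ E := fun h => hs.not_adj₂ (SimpleGraph.mem_edgesWithin.1 (hE h)).1
    refine ⟨⟨?_, ?_⟩, ⟨?_, hu, huxE⟩, ⟨?_, hv, hvyE⟩, fun h => huv.ne h.1⟩
    · rw [mem_regularFinset] at hG ⊢
      exact fun w => (hs.card_switch w).trans (hG w)
    · intro e he
      induction e with
      | h a b =>
        have := SimpleGraph.mem_edgesWithin.1 (hE he)
        refine SimpleGraph.mem_edgesWithin.2 ⟨(hs.switch_adj a b).2 (Or.inl ⟨this.1, ?_, ?_⟩), this.2⟩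
        · intro h; exact huvE (Sym2.eq_iff.2 h ▸ he)
        · intro h; exact hxyE (Sym2.eq_iff.2 h ▸ he)
    · exact (hs.switch_adj _ _).2 (by simp)
    · exact (hs.switch_adj _ _).2 (by simp)
  · rintro ⟨G, ⟨u, v⟩, ⟨x, y⟩⟩ h ⟨G', ⟨u', v'⟩, ⟨x', y'⟩⟩ h' heq
    simp only [src, Q, coe_sigma, Set.mem_sigma_iff, mem_coe, mem_filter] at h h'
    simp only [Sigma.mk.injEq, heq_eq_eq, Prod.mk.injEq] at heq
    obtain ⟨hG, ⟨rfl, rfl⟩, ⟨rfl, rfl⟩⟩ := heq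
    have := h.2.2.2.1.switch_switch
    rw [hG, h'.2.2.2.1.switch_switch] at this
    rw [this]

/-- The `k`-th factorial moment, divided by `k!` and not normalised, of the number of edges inside
`S` of a `d`-regular graph. -/
noncomputable def edgeMoment (d : ℕ) (S : Finset V) (k : ℕ) : ℕ :=
  ∑ G ∈ regularFinset V d, (#(G.edgesWithin S)).choose k

theorem edgeMoment_zero (d : ℕ) (S : Finset V) : edgeMoment d S 0 = #(regularFinset V d) := by
  simp [edgeMoment]

/-- Double counting of the pairs of a regular graph and a set of `k` of its edges inside `S`. -/
theorem sum_powersetCard_filter (d : ℕ) (S : Finset V) (k : ℕ) (g : SimpleGraph V → ℕ) :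
    ∑ E : Finset (Sym2 V) with #E = k, ∑ G ∈ regularFinset V d with E ⊆ G.edgesWithin S, g G =
      ∑ G ∈ regularFinset V d, (#(G.edgesWithin S)).choose k * g G := by
  rw [Finset.sum_comm' (s' := fun G => powersetCard k (G.edgesWithin S)) (t' := regularFinset V d)]
  · simp
  · intro E G
    simp only [mem_filter, mem_univ, true_and, mem_powersetCard]
    tauto

/-- Summing the switching inequality over the sets `E` of `k` edges inside `S`. -/
theorem edgeMoment_succ_le (d : ℕ) (S : Finset V) (k : ℕ) :
    edgeMoment d S (k + 1) * (2 * (k + 1)) * (d * Fintype.card V - 2 * k - 2 * d * (d + 1)) ≤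
      edgeMoment d S k * ((d * #S - 2 * k) * (d * #S - 2 * k - 1)) := by
  have h := sum_le_sum (s := ({E | #E = k} : Finset (Finset (Sym2 V))))
    fun E _ => sum_switchings_le d S E
  have hl : ∑ E : Finset (Sym2 V) with #E = k, (∑ G ∈ regularFinset V d with E ⊆ G.edgesWithin S,
      2 * (#(G.edgesWithin S) - #E)) * (d * Fintype.card V - 2 * #E - 2 * d * (d + 1)) =
      edgeMoment d S (k + 1) * (2 * (k + 1)) * (d * Fintype.card V - 2 * k - 2 * d * (d + 1)) := by
    calc _ = ∑ E : Finset (Sym2 V) with #E = k,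
          (∑ G ∈ regularFinset V d with E ⊆ G.edgesWithin S, 2 * (#(G.edgesWithin S) - k)) *
            (d * Fintype.card V - 2 * k - 2 * d * (d + 1)) :=
          sum_congr rfl fun E hE => by rw [(mem_filter.1 hE).2]
      _ = _ := by
          rw [← sum_mul, sum_powersetCard_filter]
          congr 1
          rw [edgeMoment, sum_mul]
          refine sum_congr rfl fun G _ => ?_
          have := Nat.choose_succ_right_eq (#(G.edgesWithin S)) k
          calc _ = 2 * ((#(G.edgesWithin S)).choose k * (#(G.edgesWithin S) - k)) := by ring
            _ = _ := by rw [← this]; ring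
  have hr : ∑ E : Finset (Sym2 V) with #E = k, ∑ G ∈ regularFinset V d with E ⊆ G.edgesWithin S,
      (d * #S - 2 * #E) * (d * #S - 2 * #E - 1) =
      edgeMoment d S k * ((d * #S - 2 * k) * (d * #S - 2 * k - 1)) := by
    calc _ = ∑ E : Finset (Sym2 V) with #E = k, ∑ G ∈ regularFinset V d with E ⊆ G.edgesWithin S,
          (d * #S - 2 * k) * (d * #S - 2 * k - 1) :=
          sum_congr rfl fun E hE => by rw [(mem_filter.1 hE).2]
      _ = _ := by rw [sum_powersetCard_filter, edgeMoment, sum_mul]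
  rwa [hl, hr] at h

/-- Iterating the recursion. The right side over `choose M k` is the bound that the configuration
model would give, up to the lower order term `d (d + 1)` in `M`. -/
theorem edgeMoment_mul_choose_le {d M : ℕ} (hM : d * Fintype.card V = 2 * M + 2 * d * (d + 1))
    (S : Finset V) (k : ℕ) :
    edgeMoment d S k * M.choose k ≤ #(regularFinset V d) * (d * #S).choose (2 * k) := by
  have key : ∀ k, edgeMoment d S k * (4 ^ k * k.factorial * M.descFactorial k) ≤
      #(regularFinset V d) * (d * #S).descFactorial (2 * k) := by
    intro k
    induction k with
    | zero => simp [edgeMoment_zero]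
    | succ k ih =>
      have h := edgeMoment_succ_le d S k
      rw [show d * Fintype.card V - 2 * k - 2 * d * (d + 1) = 2 * (M - k) by omega] at h
      rw [show 2 * (k + 1) = 2 * k + 1 + 1 by ring, Nat.descFactorial_succ, Nat.descFactorial_succ,
        Nat.descFactorial_succ, Nat.factorial_succ, pow_succ]
      calc _ = (edgeMoment d S (k + 1) * (2 * (k + 1)) * (2 * (M - k))) *
              (4 ^ k * k.factorial * M.descFactorial k) := by ring
        _ ≤ (edgeMoment d S k * ((d * #S - 2 * k) * (d * #S - 2 * k - 1))) *
              (4 ^ k * k.factorial * M.descFactorial k) := Nat.mul_le_mul_right _ h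
        _ = (edgeMoment d S k * (4 ^ k * k.factorial * M.descFactorial k)) *
              ((d * #S - 2 * k) * (d * #S - 2 * k - 1)) := by ring
        _ ≤ (#(regularFinset V d) * (d * #S).descFactorial (2 * k)) *
              ((d * #S - 2 * k) * (d * #S - 2 * k - 1)) := Nat.mul_le_mul_right _ ih
        _ = _ := by rw [Nat.sub_sub]; ring
  have h := key k
  rw [Nat.descFactorial_eq_factorial_mul_choose, Nat.descFactorial_eq_factorial_mul_choose] at h
  have hc : (2 * k).factorial ≤ 4 ^ k * k.factorial * k.factorial := by
    have h1 := Nat.choose_mul_factorial_mul_factorial (n := 2 * k) (k := k) (by omega)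
    rw [show 2 * k - k = k by omega] at h1
    have h2 : (2 * k).choose k ≤ 4 ^ k := by
      have := Nat.choose_le_two_pow (2 * k) k
      rwa [pow_mul] at this
    rw [← h1]
    gcongr
  have hpos : 0 < 4 ^ k * k.factorial * k.factorial := by positivity
  refine Nat.le_of_mul_le_mul_left ?_ hpos
  calc _ = edgeMoment d S k * (4 ^ k * k.factorial * (k.factorial * M.choose k)) := by ring
    _ ≤ #(regularFinset V d) * ((2 * k).factorial * (d * #S).choose (2 * k)) := h
    _ ≤ #(regularFinset V d) * ((4 ^ k * k.factorial * k.factorial) * (d * #S).choose (2 * k)) := by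
        gcongr
    _ = _ := by ring

/-- Markov's inequality for the factorial moment. -/
theorem card_filter_le_edgeMoment (d : ℕ) (S : Finset V) (k : ℕ) :
    #{G ∈ regularFinset V d | k ≤ #(G.edgesWithin S)} ≤ edgeMoment d S k := by
  rw [card_eq_sum_ones, edgeMoment]
  refine (sum_le_sum fun G hG => ?_).trans
    (sum_le_sum_of_subset (filter_subset _ _))
  exact Nat.choose_pos (mem_filter.1 hG).2

end FactorialMoments

/-! ### Estimates for binomial coefficients -/

section Binomial

/-- One term of Vandermonde's identity. -/
theorem choose_mul_choose_le (a b i j : ℕ) :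
    a.choose i * b.choose j ≤ (a + b).choose (i + j) := by
  rw [Nat.add_choose_eq]
  exact Finset.single_le_sum (f := fun ij : ℕ × ℕ => a.choose ij.1 * b.choose ij.2)
    (fun _ _ => Nat.zero_le _) (a := (i, j)) (by simp)

/-- The bound `(N / b) ^ b ≤ choose N b`. -/
theorem pow_le_choose_mul_pow {N b : ℕ} (h : b ≤ N) : N ^ b ≤ N.choose b * b ^ b := by
  have hb := Nat.descFactorial_eq_factorial_mul_choose N b
  have key : ∀ i ≤ b, N ^ i * b.descFactorial i ≤ N.descFactorial i * b ^ i := by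
    intro i
    induction i with
    | zero => simp
    | succ i ih =>
      intro hi
      have h1 := ih (by omega)
      have h2 : N * (b - i) ≤ (N - i) * b := by
        rw [Nat.mul_sub, Nat.sub_mul]
        have : i * b ≤ N * i := by rw [mul_comm]; exact Nat.mul_le_mul_right _ h
        omega
      rw [Nat.descFactorial_succ, Nat.descFactorial_succ, pow_succ, pow_succ]
      calc _ = (N ^ i * b.descFactorial i) * (N * (b - i)) := by ring
        _ ≤ (N.descFactorial i * b ^ i) * ((N - i) * b) := Nat.mul_le_mul h1 h2
        _ = _ := by ring
  have h1 := key b le_rfl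
  rw [Nat.descFactorial_self, hb] at h1
  refine Nat.le_of_mul_le_mul_left ?_ b.factorial_pos
  linarith

/-- Chernoff's bound: one term of the binomial expansion of `(1 / 64 + 1) ^ m` is at most the
sum. -/
theorem choose_le_pow_mul_pow (m j : ℕ) (hj : j ≤ m) :
    ((m.choose j : ℕ) : ℝ) ≤ (65 / 64 : ℝ) ^ m * 64 ^ j := by
  have h := add_pow (1 / 64 : ℝ) 1 m
  have h1 : (1 / 64 : ℝ) ^ j * 1 ^ (m - j) * (m.choose j : ℕ) ≤ (1 / 64 + 1) ^ m := by
    rw [h]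
    exact Finset.single_le_sum
      (f := fun j => (1 / 64 : ℝ) ^ j * 1 ^ (m - j) * (m.choose j : ℕ))
      (fun _ _ => by positivity) (Finset.mem_range.2 (by omega))
  rw [one_pow, mul_one, one_div, inv_pow, show ((64 : ℝ)⁻¹ + 1) = 65 / 64 by norm_num] at h1
  calc ((m.choose j : ℕ) : ℝ) = ((64 ^ j)⁻¹ * (m.choose j : ℕ)) * 64 ^ j := by
        field_simp
    _ ≤ _ := by gcongr

/-- As `D - 2 k ≤ D / 60`, the binomial coefficient is exponentially less than `2 ^ (k - s)`: in
Chernoff's bound `64 ^ (D - 2 k)` is `2 ^ (6 (D - 2 k))`, and `6 (D - 2 k) + D / 22 ≤ k - s`, while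
`(65 / 64) ^ 44 ≤ 2`. -/
theorem choose_le_two_pow_div {D s k : ℕ} (hs : 3 * s ≤ D) (hk : 59 * D ≤ 120 * k)
    (hk' : 2 * k ≤ D) :
    ((D.choose (2 * k) : ℕ) : ℝ) ≤ 2 ^ (k - s) * (64 / 65 : ℝ) ^ D := by
  rw [← Nat.choose_symm hk']
  refine (choose_le_pow_mul_pow D (D - 2 * k) (by omega)).trans ?_
  have h2 : (65 / 64 : ℝ) ^ 44 ≤ 2 := by norm_num
  obtain ⟨r, hr⟩ : ∃ r, k - s = 6 * (D - 2 * k) + r := ⟨k - s - 6 * (D - 2 * k), by omega⟩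
  have hr' : 2 * D ≤ 44 * r := by omega
  have h3 : (65 / 64 : ℝ) ^ (2 * D) ≤ 2 ^ r :=
    calc (65 / 64 : ℝ) ^ (2 * D) ≤ (65 / 64 : ℝ) ^ (44 * r) :=
          pow_le_pow_right₀ (by norm_num) hr'
      _ = ((65 / 64 : ℝ) ^ 44) ^ r := by rw [pow_mul]
      _ ≤ 2 ^ r := by gcongr
  have h4 : (65 / 64 : ℝ) ^ D ≤ 2 ^ r * (64 / 65 : ℝ) ^ D := by
    calc (65 / 64 : ℝ) ^ D = (65 / 64 : ℝ) ^ (2 * D) * (64 / 65 : ℝ) ^ D := by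
          rw [two_mul, pow_add, mul_assoc, ← mul_pow]; norm_num
      _ ≤ _ := by gcongr
  rw [hr, pow_add, pow_mul]
  calc (65 / 64 : ℝ) ^ D * 64 ^ (D - 2 * k) ≤ (2 ^ r * (64 / 65 : ℝ) ^ D) * 64 ^ (D - 2 * k) := by
        gcongr
    _ = _ := by norm_num; ring

/-- The left side divided by `choose (n + N) k` will be, for `D = d s`, the bound for the expected
number of sets of size `s` that span `k` edges. It is summable over `s`, and tends to `0` as `N`
grows. -/
theorem choose_mul_choose_div_le {n N D s k : ℕ} (hD : 3 * s ≤ D) (hs : 0 < s)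
    (hk : 59 * D ≤ 120 * k) (hN : 2 * (k - s) ≤ N) :
    (n.choose s : ℝ) * (D.choose (2 * k) : ℕ) ≤
      ((n + N).choose k : ℕ) * (2 * (D * (64 / 65 : ℝ) ^ D) / N) := by
  -- rounding may make `2 k` exceed `D`, and then the binomial coefficient vanishes
  rcases lt_or_ge D (2 * k) with hk' | hk'
  · rw [Nat.choose_eq_zero_of_lt hk', Nat.cast_zero, mul_zero]
    positivity
  obtain ⟨b, hb⟩ : ∃ b, k = s + b := ⟨k - s, by omega⟩
  have hb1 : 1 ≤ b := by omega
  obtain rfl : b = k - s := by omega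
  set b := k - s
  have hNpos : (0 : ℝ) < N := by
    have : 0 < N := by omega
    exact_mod_cast this
  have hv := choose_mul_choose_le n N s b
  rw [← hb] at hv
  have hv' : (n.choose s : ℝ) * (N.choose b : ℕ) ≤ ((n + N).choose k : ℕ) := by exact_mod_cast hv
  have hp : (N : ℝ) ^ b ≤ (N.choose b : ℕ) * (b : ℝ) ^ b := by
    exact_mod_cast pow_le_choose_mul_pow (N := N) (b := b) (by omega)
  -- one factor `N / b` is kept, so that the bound vanishes for large `N`; the others are at least `2`
  have h2 : ((2 : ℝ) * b) ^ (b - 1) ≤ (N : ℝ) ^ (b - 1) := by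
    gcongr; exact_mod_cast hN
  have e1 : ∀ x : ℝ, x ^ b = x * x ^ (b - 1) := fun x => by
    rw [← pow_succ']; congr 1; omega
  have hbpos : (0 : ℝ) < b := by exact_mod_cast hb1
  have h3 : (2 : ℝ) ^ b ≤ (N.choose b : ℕ) * (2 * b / N) := by
    have : (N : ℝ) * ((2 * b) ^ (b - 1)) ≤ (N.choose b : ℕ) * (b : ℝ) ^ b :=
      le_trans (by rw [e1]; gcongr) hp
    rw [mul_pow, e1 (b : ℝ)] at this
    have h' : (N : ℝ) * 2 ^ (b - 1) ≤ (N.choose b : ℕ) * b := by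
      have hpos : (0 : ℝ) < (b : ℝ) ^ (b - 1) := by positivity
      refine le_of_mul_le_mul_right ?_ hpos
      linarith
    rw [e1, mul_div_assoc', le_div_iff₀ hNpos]
    linarith
  have hbD : (b : ℝ) ≤ D := by
    have : b ≤ D := by omega
    exact_mod_cast this
  calc (n.choose s : ℝ) * (D.choose (2 * k) : ℕ)
      ≤ n.choose s * (2 ^ b * (64 / 65 : ℝ) ^ D) := by
        gcongr; exact choose_le_two_pow_div hD hk hk'
    _ ≤ n.choose s * (((N.choose b : ℕ) * (2 * b / N)) * (64 / 65 : ℝ) ^ D) := by gcongr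
    _ = (n.choose s * (N.choose b : ℕ)) * ((2 * b / N) * (64 / 65 : ℝ) ^ D) := by ring
    _ ≤ ((n + N).choose k : ℕ) * ((2 * D / N) * (64 / 65 : ℝ) ^ D) := by gcongr
    _ = _ := by ring

end Binomial

/-! ### Spread of vertex expanders -/

section Spread

open Finset

open scoped Classical

variable {V : Type*} [Fintype V]

/-- The vertices outside `S` that have a neighbour in `S`. -/
noncomputable def SimpleGraph.outerBoundary (G : SimpleGraph V) (S : Finset V) : Finset V :=
  {w | w ∉ S ∧ ∃ v ∈ S, G.Adj v w}

/-- Every set of at most half of the vertices has at least `1 / K` times as many neighbours outside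
as it has elements. -/
def SimpleGraph.IsVertexExpander (G : SimpleGraph V) (K : ℕ) : Prop :=
  ∀ S : Finset V, 2 * #S ≤ Fintype.card V → #S ≤ K * #(G.outerBoundary S)

/-- A median: the greatest value of `f` below which `f` takes at most half of its values. -/
theorem exists_median (f : V → ℝ) :
    ∃ m : ℝ, 2 * #{v | m < f v} ≤ Fintype.card V ∧ 2 * #{v | f v < m} ≤ Fintype.card V := by
  rcases isEmpty_or_nonempty V with hV | hV
  · exact ⟨0, by simp⟩
  have hne : ({v | 2 * #{w | f w < f v} ≤ Fintype.card V} : Finset V).Nonempty := by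
    obtain ⟨v, -, hv⟩ := exists_min_image univ f univ_nonempty
    refine ⟨v, ?_⟩
    have : ({w | f w < f v} : Finset V) = ∅ := by
      ext w; simpa using hv w (mem_univ w)
    simp [this]
  obtain ⟨v, hv, hmax⟩ := exists_max_image _ f hne
  refine ⟨f v, ?_, (mem_filter.1 hv).2⟩
  rcases ({w | f v < f w} : Finset V).eq_empty_or_nonempty with h0 | h0
  · simp [h0]
  obtain ⟨b, hb, hmin⟩ := exists_min_image _ f h0
  have hb' := (mem_filter.1 hb).2
  have h1 : Fintype.card V < 2 * #{w | f w < f b} := by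
    by_contra! hcon
    exact absurd (hmax b (mem_filter.2 ⟨mem_univ _, hcon⟩)) (not_le.2 hb')
  have h2 : ({w | f v < f w} : Finset V) ⊆ ({w | ¬ f w < f b} : Finset V) := by
    intro w hw
    simpa using hmin w hw
  have h3 := card_le_card h2
  have h4 := card_filter_add_card_filter_not (s := (univ : Finset V)) (fun w => f w < f b)
  rw [card_univ] at h4
  omega

/-- The neighbours of a level set of a Lipschitz function lie in the next lower level set, so the
level sets above a median decay geometrically. -/
theorem SimpleGraph.IsVertexExpander.card_level_le {G : SimpleGraph V} {K : ℕ}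
    (hG : G.IsVertexExpander K) {f : V → ℝ} (hf : G.IsLipschitzFun f) {m : ℝ}
    (hm : 2 * #{v | m < f v} ≤ Fintype.card V) (t : ℕ) :
    (#{v | m + t < f v} : ℝ) ≤ (K / (K + 1) : ℝ) ^ t * (Fintype.card V / 2) := by
  induction t with
  | zero =>
    have : (2 * #{v | m < f v} : ℝ) ≤ Fintype.card V := by exact_mod_cast hm
    simp only [Nat.cast_zero, add_zero, pow_zero, one_mul]
    linarith
  | succ t ih =>
    set A : Finset V := {v | m + (t + 1 : ℕ) < f v} with hA
    have hA0 : 2 * #A ≤ Fintype.card V := by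
      refine le_trans (Nat.mul_le_mul_left 2 (card_le_card fun v hv => ?_)) hm
      simp only [hA, mem_filter, mem_univ, true_and, Nat.cast_add, Nat.cast_one] at hv ⊢
      have : (0 : ℝ) ≤ t := Nat.cast_nonneg t
      linarith
    have hsub : A ∪ G.outerBoundary A ⊆ ({v | m + t < f v} : Finset V) := by
      intro w hw
      simp only [mem_union, SimpleGraph.outerBoundary, mem_filter, mem_univ, true_and, hA,
        Nat.cast_add, Nat.cast_one] at hw ⊢
      rcases hw with hw | ⟨-, v, hv, hvw⟩
      · linarith
      · have := (abs_le.1 (hf v w hvw)).2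
        linarith
    have hdisj : Disjoint A (G.outerBoundary A) := by
      rw [Finset.disjoint_left]
      intro v hv hv'
      exact (mem_filter.1 hv').2.1 hv
    have h1 := card_le_card hsub
    rw [card_union_of_disjoint hdisj] at h1
    have h2 := hG A hA0
    have h3 : (K + 1) * #A ≤ K * #{v | m + t < f v} := by
      calc (K + 1) * #A = K * #A + #A := by ring
        _ ≤ K * #A + K * #(G.outerBoundary A) := by omega
        _ = K * (#A + #(G.outerBoundary A)) := by ring
        _ ≤ _ := Nat.mul_le_mul_left _ h1
    have h4 : ((K : ℝ) + 1) * #A ≤ K * #{v | m + t < f v} := by exact_mod_cast h3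
    have hK : (0 : ℝ) < (K : ℝ) + 1 := by positivity
    calc (#A : ℝ) ≤ (K / (K + 1) : ℝ) * #{v | m + t < f v} := by
          rw [div_mul_eq_mul_div, le_div_iff₀ hK]; linarith
      _ ≤ (K / (K + 1) : ℝ) * ((K / (K + 1) : ℝ) ^ t * (Fintype.card V / 2)) := by gcongr
      _ = _ := by ring

/-- The bound for the spread of a vertex expander: the weight `2 j + 1` is the increment of the
squares, and `(K / (K + 1)) ^ j` bounds the proportion of vertices at which a Lipschitz function
differs from its median by more than `j`. -/
noncomputable def spreadConst (K : ℕ) : ℝ := ∑' j : ℕ, (2 * j + 1 : ℝ) * (K / (K + 1) : ℝ) ^ j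

theorem summable_spreadConst (K : ℕ) :
    Summable fun j : ℕ => (2 * j + 1 : ℝ) * (K / (K + 1) : ℝ) ^ j := by
  have hq : ‖(K / (K + 1) : ℝ)‖ < 1 := by
    rw [Real.norm_of_nonneg (by positivity), div_lt_one (by positivity)]
    linarith
  have h1 := (summable_pow_mul_geometric_of_norm_lt_one 1 hq).mul_left 2
  have h2 := summable_geometric_of_norm_lt_one hq
  refine (h1.add h2).congr fun j => ?_
  simp; ring

theorem spreadConst_pos (K : ℕ) : 0 < spreadConst K := by
  refine (summable_spreadConst K).tsum_pos (fun j => by positivity) 0 ?_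
  simp

theorem sq_le_sum_indicator {x : ℝ} {J : ℕ} (hx : |x| ≤ J) :
    x ^ 2 ≤ ∑ j ∈ range J, (2 * j + 1 : ℝ) * (if (j : ℝ) < |x| then 1 else 0) := by
  have hsum : ∀ a : ℕ, ∑ j ∈ range a, (2 * j + 1 : ℝ) = (a : ℝ) ^ 2 := by
    intro a
    induction a with
    | zero => simp
    | succ a ih => rw [sum_range_succ, ih]; push_cast; ring
  have ha : ⌈|x|⌉₊ ≤ J := Nat.ceil_le.2 hx
  calc x ^ 2 = |x| ^ 2 := (sq_abs x).symm
    _ ≤ (⌈|x|⌉₊ : ℝ) ^ 2 := by gcongr; exact Nat.le_ceil _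
    _ = ∑ j ∈ range ⌈|x|⌉₊, (2 * j + 1 : ℝ) * (if (j : ℝ) < |x| then 1 else 0) := by
        rw [← hsum]
        refine sum_congr rfl fun j hj => ?_
        rw [if_pos (Nat.lt_ceil.1 (mem_range.1 hj)), mul_one]
    _ ≤ _ := by
        refine sum_le_sum_of_subset_of_nonneg (range_mono ha) fun j _ _ => ?_
        split_ifs <;> positivity

theorem SimpleGraph.IsVertexExpander.sum_sq_le {G : SimpleGraph V} {K : ℕ}
    (hG : G.IsVertexExpander K) {f : V → ℝ} (hf : G.IsLipschitzFun f) :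
    ∃ m : ℝ, ∑ v, (f v - m) ^ 2 ≤ spreadConst K * Fintype.card V := by
  obtain ⟨m, hm1, hm2⟩ := exists_median f
  refine ⟨m, ?_⟩
  -- `-f` is used for the level sets below the median
  have hf' : G.IsLipschitzFun (-f) := fun v w h => by
    have := hf w v h.symm
    rw [Pi.neg_apply, Pi.neg_apply, show -f v - -f w = f w - f v by ring]
    exact this
  obtain ⟨J, hJ⟩ : ∃ J : ℕ, ∀ v, |f v - m| ≤ J := by
    refine ⟨∑ v, ⌈|f v - m|⌉₊, fun v => (Nat.le_ceil _).trans ?_⟩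
    exact_mod_cast single_le_sum (f := fun v => ⌈|f v - m|⌉₊) (fun _ _ => Nat.zero_le _) (mem_univ v)
  have hlevel : ∀ j : ℕ, (#{v | (j : ℝ) < |f v - m|} : ℝ) ≤
      (K / (K + 1) : ℝ) ^ j * Fintype.card V := by
    intro j
    have h1 := hG.card_level_le hf hm1 j
    have h2 := hG.card_level_le hf' (m := -m) (by simpa using hm2) j
    have h3 : ({v | (j : ℝ) < |f v - m|} : Finset V) ⊆
        ({v | m + j < f v} : Finset V) ∪ ({v | -m + j < (-f) v} : Finset V) := by
      intro v
      simp only [mem_union, mem_filter, mem_univ, true_and, lt_abs, Pi.neg_apply]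
      rintro (h | h)
      · left; linarith
      · right; linarith
    have h4 : (#{v | (j : ℝ) < |f v - m|} : ℝ) ≤
        #{v | m + j < f v} + #{v | -m + j < (-f) v} := by
      exact_mod_cast (card_le_card h3).trans (card_union_le _ _)
    linarith
  calc ∑ v, (f v - m) ^ 2
      ≤ ∑ v, ∑ j ∈ range J, (2 * j + 1 : ℝ) * (if (j : ℝ) < |f v - m| then 1 else 0) :=
        sum_le_sum fun v _ => sq_le_sum_indicator (hJ v)
    _ = ∑ j ∈ range J, (2 * j + 1 : ℝ) * #{v | (j : ℝ) < |f v - m|} := by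
        rw [sum_comm]
        refine sum_congr rfl fun j _ => ?_
        rw [← mul_sum]; simp
    _ ≤ ∑ j ∈ range J, (2 * j + 1 : ℝ) * ((K / (K + 1) : ℝ) ^ j * Fintype.card V) :=
        sum_le_sum fun j _ => mul_le_mul_of_nonneg_left (hlevel j) (by positivity)
    _ = (∑ j ∈ range J, (2 * j + 1 : ℝ) * (K / (K + 1) : ℝ) ^ j) * Fintype.card V := by
        rw [sum_mul]; simp only [mul_assoc]
    _ ≤ spreadConst K * Fintype.card V := by
        gcongr
        exact (summable_spreadConst K).sum_le_tsum _ fun j _ => by positivity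

/-- The variance is the least mean squared distance to a constant. -/
theorem uniformVariance_le (f : V → ℝ) (m : ℝ) :
    uniformVariance f ≤ (∑ v, (f v - m) ^ 2) / Fintype.card V := by
  unfold uniformVariance
  rw [uniformMean]
  gcongr ?_ / _
  rcases isEmpty_or_nonempty V with hV | hV
  · simp
  have hn : (Fintype.card V : ℝ) ≠ 0 := by simp
  have hmean : ∑ v, f v = Fintype.card V * uniformMean f := by
    rw [uniformMean]; field_simp
  have : ∑ v, (f v - m) ^ 2 =
      ∑ v, (f v - uniformMean f) ^ 2 + Fintype.card V * (uniformMean f - m) ^ 2 := by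
    have : ∀ v, (f v - m) ^ 2 = (f v - uniformMean f) ^ 2 +
        (2 * (uniformMean f - m) * f v - 2 * (uniformMean f - m) * uniformMean f
          + (uniformMean f - m) ^ 2) := fun v => by ring
    simp only [this, sum_add_distrib, sum_sub_distrib, ← mul_sum, hmean, sum_const, card_univ,
      nsmul_eq_mul]
    ring
  rw [this]
  have : 0 ≤ (Fintype.card V : ℝ) * (uniformMean f - m) ^ 2 := by positivity
  linarith

theorem SimpleGraph.IsVertexExpander.spread_le {G : SimpleGraph V} {K : ℕ}
    (hG : G.IsVertexExpander K) : G.spread ≤ ENNReal.ofReal (spreadConst K) := by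
  refine iSup₂_le fun f hf => ENNReal.ofReal_le_ofReal ?_
  obtain ⟨m, hm⟩ := hG.sum_sq_le hf
  refine (uniformVariance_le f m).trans ?_
  exact div_le_of_le_mul₀ (Nat.cast_nonneg _) (spreadConst_pos K).le hm

/-- A set of vertices with few outer neighbours spans many edges. -/
theorem card_le_edgesWithin_add_outerBoundary {d : ℕ} {G : SimpleGraph V}
    (hG : G ∈ regularFinset V d) (S : Finset V) :
    d * #S ≤ 2 * #(G.edgesWithin S) + d * #(G.outerBoundary S) := by
  rw [← card_darts hG, ← card_darts_within, ← card_darts hG]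
  have hsub : ({p : V × V | G.Adj p.1 p.2 ∧ p.1 ∈ S} : Finset (V × V)) ⊆
      ({p : V × V | G.Adj p.1 p.2 ∧ p.1 ∈ S ∧ p.2 ∈ S} : Finset (V × V)) ∪
      ({p : V × V | G.Adj p.1 p.2 ∧ p.1 ∈ G.outerBoundary S} : Finset (V × V)).image Prod.swap := by
    rintro ⟨a, b⟩ h
    simp only [mem_filter, mem_univ, true_and, mem_union, mem_image, Prod.exists,
      SimpleGraph.outerBoundary] at h ⊢
    by_cases hb : b ∈ S
    · exact Or.inl ⟨h.1, h.2, hb⟩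
    · exact Or.inr ⟨b, a, ⟨h.1.symm, hb, a, h.2, h.1⟩, rfl⟩
  have h := (card_le_card hsub).trans (card_union_le _ _)
  have h' := card_image_le (f := Prod.swap)
    (s := ({p : V × V | G.Adj p.1 p.2 ∧ p.1 ∈ G.outerBoundary S} : Finset (V × V)))
  omega

/-- A regular graph in which no set of at most half of the vertices spans nearly all of its edge
endpoints is a vertex expander. -/
theorem isVertexExpander_of_edgesWithin {d : ℕ} (hd : 0 < d) {G : SimpleGraph V}
    (hG : G ∈ regularFinset V d)
    (h : ∀ S : Finset V, S.Nonempty → 2 * #S ≤ Fintype.card V →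
      120 * #(G.edgesWithin S) < 59 * (d * #S)) :
    G.IsVertexExpander 60 := by
  intro S hS
  rcases S.eq_empty_or_nonempty with rfl | hne
  · simp
  have h1 := card_le_edgesWithin_add_outerBoundary hG S
  have h2 := h S hne hS
  refine Nat.le_of_mul_le_mul_left ?_ hd
  rw [Nat.mul_left_comm]
  omega

end Spread

/-! ### Existence of regular graphs -/

section Existence

open Finset

open scoped Classical

/-- The Cayley graph of a symmetric set of `d` non-zero elements is `d`-regular. -/
theorem regularFinset_nonempty_of_connectionSet {A : Type*} [AddCommGroup A] [Fintype A]
    (T : Finset A) (h0 : 0 ∉ T) (hneg : ∀ x ∈ T, -x ∈ T) :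
    (regularFinset A #T).Nonempty := by
  refine ⟨⟨fun u v => v - u ∈ T, ⟨fun u v h => ?_⟩, ⟨fun u h => h0 (by simpa using h)⟩⟩, ?_⟩
  · have := hneg _ h
    rwa [neg_sub] at this
  · rw [mem_regularFinset]
    intro v
    refine Finset.card_bij' (fun w _ => w - v) (fun t _ => t + v) ?_ ?_ ?_ ?_ <;> simp

theorem regularFinset_fin_nonempty {n d : ℕ} (hd : d < n) (hnd : Even (d * n)) :
    (regularFinset (Fin n) d).Nonempty := by
  have : NeZero n := ⟨by omega⟩
  -- the residues at distance at most `d / 2` from `0`, and the residue `n / 2` if `d` is odd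
  let J : Finset ℕ := Icc 1 (d / 2) ∪ Icc (n - d / 2) (n - 1) ∪ if Odd d then {n / 2} else ∅
  have hJ : ∀ x ∈ J, 0 < x ∧ x < n ∧ n - x ∈ J := by
    intro x hx
    simp only [J, mem_union, mem_Icc] at hx ⊢
    split_ifs at hx ⊢ with hodd
    · have hn : Even n := (Nat.even_mul.1 hnd).resolve_left (Nat.not_even_iff_odd.2 hodd)
      obtain ⟨m, rfl⟩ := hn
      simp only [mem_singleton] at hx ⊢
      omega
    · simp only [notMem_empty, or_false] at hx ⊢
      omega
  have hcard : #J = d := by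
    have h1 : Disjoint (Icc 1 (d / 2)) (Icc (n - d / 2) (n - 1)) := by
      rw [Finset.disjoint_left]; intro x; simp only [mem_Icc]; omega
    by_cases hodd : Odd d
    · have hn : Even n := (Nat.even_mul.1 hnd).resolve_left (Nat.not_even_iff_odd.2 hodd)
      obtain ⟨m, rfl⟩ := hn
      obtain ⟨e, rfl⟩ := hodd
      have h2 : Disjoint (Icc 1 ((2 * e + 1) / 2) ∪ Icc (m + m - (2 * e + 1) / 2) (m + m - 1))
          {(m + m) / 2} := by
        rw [Finset.disjoint_left]; intro x; simp only [mem_union, mem_Icc, mem_singleton]; omega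
      simp only [J]
      rw [if_pos ⟨e, rfl⟩, card_union_of_disjoint h2, card_union_of_disjoint h1]
      simp only [Nat.card_Icc, card_singleton]
      omega
    · obtain ⟨e, rfl⟩ := Nat.not_odd_iff_even.1 hodd
      simp only [J]
      rw [if_neg hodd, union_empty, card_union_of_disjoint h1]
      simp only [Nat.card_Icc]
      omega
  let T : Finset (Fin n) := {x | x.val ∈ J}
  have hT : #T = d := by
    rw [← hcard, ← card_map Fin.valEmbedding]
    congr 1
    ext x
    simp only [T, Finset.mem_map, mem_filter, mem_univ, true_and, Fin.valEmbedding_apply]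
    exact ⟨by rintro ⟨a, ha, rfl⟩; exact ha, fun hx => ⟨⟨x, (hJ x hx).2.1⟩, hx, rfl⟩⟩
  rw [← hT]
  refine regularFinset_nonempty_of_connectionSet T ?_ ?_
  · intro h
    have := (hJ _ (mem_filter.1 h).2).1
    simp at this
  · intro x hx
    simp only [T, mem_filter, mem_univ, true_and] at hx ⊢
    have h := hJ _ hx
    have hv : (-x).val = n - x.val := by
      rw [Fin.val_neg, if_neg]
      rintro rfl
      simp at h
    rw [hv]
    exact h.2.2

end Existence

/-! ### Random regular graphs are expanders with bounded spread -/

section RandomRegular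

open Finset

open scoped Classical

theorem regularGraphs_eq (n d : ℕ) : regularGraphs n d = regularFinset (Fin n) d := by
  ext G
  simp only [regularGraphs, Set.mem_ofPred_eq, mem_coe, mem_regularFinset,
    SimpleGraph.IsRegularOfDegree]
  refine forall_congr' fun v => ?_
  rw [← SimpleGraph.card_neighborFinset_eq_degree, SimpleGraph.neighborFinset_eq_filter]

theorem randomRegularProb_eq (n d : ℕ) (P : SimpleGraph (Fin n) → Prop) :
    randomRegularProb n d P =
      (#{G ∈ regularFinset (Fin n) d | P G} : ℝ) / #(regularFinset (Fin n) d) := by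
  have : {G ∈ regularGraphs n d | P G} =
      (({G ∈ regularFinset (Fin n) d | P G} : Finset _) : Set (SimpleGraph (Fin n))) := by
    ext G; simp [regularGraphs_eq]
  rw [randomRegularProb, this, regularGraphs_eq, Set.ncard_coe_finset, Set.ncard_coe_finset]

/-- The number of `d`-regular graphs in which some set of size `s` spans at least
`⌈59 d s / 120⌉` edges. -/
theorem card_dense_le {n d N : ℕ} (hd : 3 ≤ d) (hN : d * n = 2 * (n + N) + 2 * d * (d + 1))
    (hN1 : ∀ k s : ℕ, 2 * s ≤ n → 120 * k ≤ 59 * (d * s) + 119 → 2 * (k - s) ≤ N)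
    {s : ℕ} (hs : 0 < s) (hsn : 2 * s ≤ n) :
    (#{G ∈ regularFinset (Fin n) d | ∃ S : Finset (Fin n), #S = s ∧
      59 * (d * s) ≤ 120 * #(G.edgesWithin S)} : ℝ) ≤
    #(regularFinset (Fin n) d) * (2 * ((d * s : ℕ) * (64 / 65 : ℝ) ^ (d * s)) / N) := by
  set R := regularFinset (Fin n) d
  set k := (59 * (d * s) + 119) / 120 with hk
  have hds : 3 * s ≤ d * s := Nat.mul_le_mul_right _ hd
  have h1 : #{G ∈ R | ∃ S : Finset (Fin n), #S = s ∧ 59 * (d * s) ≤ 120 * #(G.edgesWithin S)} ≤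
      ∑ S ∈ powersetCard s (univ : Finset (Fin n)), edgeMoment d S k := by
    have hsub : {G ∈ R | ∃ S : Finset (Fin n), #S = s ∧ 59 * (d * s) ≤ 120 * #(G.edgesWithin S)} ⊆
        (powersetCard s (univ : Finset (Fin n))).biUnion
          fun S => {G ∈ R | k ≤ #(G.edgesWithin S)} := by
      intro G hG
      obtain ⟨hGR, S, hS, hS'⟩ := mem_filter.1 hG
      refine mem_biUnion.2 ⟨S, mem_powersetCard.2 ⟨subset_univ _, hS⟩, mem_filter.2 ⟨hGR, ?_⟩⟩
      omega
    exact (card_le_card hsub).trans (card_biUnion_le.trans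
      (sum_le_sum fun S _ => card_filter_le_edgeMoment d S k))
  have h2 : (∑ S ∈ powersetCard s (univ : Finset (Fin n)), edgeMoment d S k) * (n + N).choose k ≤
      n.choose s * (#R * (d * s).choose (2 * k)) := by
    rw [sum_mul]
    refine (sum_le_card_nsmul _ _ (#R * (d * s).choose (2 * k)) fun S hS => ?_).trans ?_
    · have := edgeMoment_mul_choose_le (M := n + N) (d := d) (by rw [Fintype.card_fin, hN]) S k
      rwa [(mem_powersetCard.1 hS).2] at this
    · simp
  have h3 := choose_mul_choose_div_le (n := n) (N := N) (D := d * s) (s := s) (k := k) hds hs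
    (by omega) (hN1 k s hsn (by omega))
  have hkN : k ≤ n + N := by
    have := hN1 k s hsn (by omega)
    omega
  have hpos : (0 : ℝ) < ((n + N).choose k : ℕ) := by exact_mod_cast Nat.choose_pos hkN
  refine le_of_mul_le_mul_right ?_ hpos
  have h4 : (#{G ∈ R | ∃ S : Finset (Fin n), #S = s ∧
      59 * (d * s) ≤ 120 * #(G.edgesWithin S)} : ℝ) * ((n + N).choose k : ℕ) ≤
      n.choose s * (#R * ((d * s).choose (2 * k) : ℕ)) := by
    exact_mod_cast (Nat.mul_le_mul_right _ h1).trans h2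
  calc _ ≤ (n.choose s : ℝ) * (#R * ((d * s).choose (2 * k) : ℕ)) := h4
    _ = #R * ((n.choose s : ℝ) * ((d * s).choose (2 * k) : ℕ)) := by ring
    _ ≤ #R * (((n + N).choose k : ℕ) * (2 * ((d * s : ℕ) * (64 / 65 : ℝ) ^ (d * s)) / N)) := by
        gcongr
    _ = _ := by ring

/-- The union bound over all sizes `s ≤ n / 2`. -/
theorem card_not_expander_le {n d N : ℕ} (hd : 3 ≤ d)
    (hN : d * n = 2 * (n + N) + 2 * d * (d + 1))
    (hN1 : ∀ k s : ℕ, 2 * s ≤ n → 120 * k ≤ 59 * (d * s) + 119 → 2 * (k - s) ≤ N) :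
    (#{G ∈ regularFinset (Fin n) d | ¬ G.IsVertexExpander 60} : ℝ) ≤
      #(regularFinset (Fin n) d) * ((2 * ∑' D : ℕ, (D : ℝ) * (64 / 65 : ℝ) ^ D) / N) := by
  set R := regularFinset (Fin n) d
  have hsummable : Summable fun D : ℕ => (D : ℝ) * (64 / 65 : ℝ) ^ D := by
    have := summable_pow_mul_geometric_of_norm_lt_one 1 (r := (64 / 65 : ℝ))
      (by rw [Real.norm_of_nonneg] <;> norm_num)
    simpa using this
  have hsub : {G ∈ R | ¬ G.IsVertexExpander 60} ⊆ (Icc 1 (n / 2)).biUnion fun s =>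
      {G ∈ R | ∃ S : Finset (Fin n), #S = s ∧ 59 * (d * s) ≤ 120 * #(G.edgesWithin S)} := by
    intro G hG
    obtain ⟨hGR, hG'⟩ := mem_filter.1 hG
    by_contra hcon
    refine hG' (isVertexExpander_of_edgesWithin (by omega) hGR fun S hne hS => ?_)
    by_contra! hlt
    rw [Fintype.card_fin] at hS
    exact hcon (mem_biUnion.2 ⟨#S, mem_Icc.2 ⟨hne.card_pos, by omega⟩,
      mem_filter.2 ⟨hGR, S, rfl, hlt⟩⟩)
  have h1 : (#{G ∈ R | ¬ G.IsVertexExpander 60} : ℝ) ≤ ∑ s ∈ Icc 1 (n / 2),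
      (#{G ∈ R | ∃ S : Finset (Fin n), #S = s ∧ 59 * (d * s) ≤ 120 * #(G.edgesWithin S)} : ℝ) := by
    exact_mod_cast (card_le_card hsub).trans card_biUnion_le
  have h2 : ∑ s ∈ Icc 1 (n / 2), ((d * s : ℕ) : ℝ) * (64 / 65 : ℝ) ^ (d * s) ≤
      ∑' D : ℕ, (D : ℝ) * (64 / 65 : ℝ) ^ D := by
    rw [← sum_image (g := fun s => d * s) (f := fun D : ℕ => (D : ℝ) * (64 / 65 : ℝ) ^ D)
      (fun a _ b _ h => Nat.eq_of_mul_eq_mul_left (by omega) h)]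
    exact hsummable.sum_le_tsum _ fun _ _ => by positivity
  calc _ ≤ _ := h1
    _ ≤ ∑ s ∈ Icc 1 (n / 2), #R * (2 * ((d * s : ℕ) * (64 / 65 : ℝ) ^ (d * s)) / N) :=
        sum_le_sum fun s hs => by
          have := mem_Icc.1 hs
          exact card_dense_le hd hN hN1 this.1 (by omega)
    _ = #R * ((2 * ∑ s ∈ Icc 1 (n / 2), ((d * s : ℕ) : ℝ) * (64 / 65 : ℝ) ^ (d * s)) / N) := by
        rw [← mul_sum, ← sum_div, ← mul_sum]
    _ ≤ _ := by gcongr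

/-- The first quotient is `1` if there are `d`-regular graphs, and `0` by convention otherwise. -/
theorem le_randomRegularProb {n d : ℕ} {P Q : SimpleGraph (Fin n) → Prop} (h : ∀ G, Q G → P G) :
    (#(regularFinset (Fin n) d) : ℝ) / #(regularFinset (Fin n) d) -
      (#{G ∈ regularFinset (Fin n) d | ¬ Q G} : ℝ) / #(regularFinset (Fin n) d) ≤
      randomRegularProb n d P := by
  rw [randomRegularProb_eq, ← sub_div]
  gcongr ?_ / _
  rw [sub_le_iff_le_add]
  have hsplit : #(regularFinset (Fin n) d) ≤ #{G ∈ regularFinset (Fin n) d | P G} +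
      #{G ∈ regularFinset (Fin n) d | ¬ Q G} := by
    rw [← card_filter_add_card_filter_not (s := regularFinset (Fin n) d) Q]
    gcongr with G
    exact h G
  exact_mod_cast hsplit

/-- The hypothesis on `n` makes the lower order terms in `d` harmless. -/
theorem randomRegularProb_spread_ge {n d : ℕ} (hd : 3 ≤ d) (hn : 120 * (d + 2) ^ 2 ≤ n)
    (hnd : Even (d * n)) :
    1 - (16 * ∑' D : ℕ, (D : ℝ) * (64 / 65 : ℝ) ^ D) / n ≤
      randomRegularProb n d fun G => G.spread ≤ ENNReal.ofReal (spreadConst 60) := by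
  have hd2 : d * (d + 1) + 2 ≤ (d + 2) ^ 2 := by ring_nf; omega
  obtain ⟨m, hm⟩ := hnd
  have hdn : 3 * n ≤ d * n := Nat.mul_le_mul_right _ hd
  obtain ⟨N, hN⟩ : ∃ N, m = n + N + d * (d + 1) := ⟨m - n - d * (d + 1), by omega⟩
  have h8 : n ≤ 8 * N := by omega
  have hNeq : d * n = 2 * (n + N) + 2 * d * (d + 1) := by rw [mul_assoc]; omega
  have hN1 : ∀ k s : ℕ, 2 * s ≤ n → 120 * k ≤ 59 * (d * s) + 119 → 2 * (k - s) ≤ N := by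
    intro k s hs hk
    obtain ⟨r, hr⟩ := Nat.exists_eq_add_of_le hs
    have h1 : d * n = 2 * (d * s) + d * r := by rw [hr]; ring
    have h2 : 3 * r ≤ d * r := Nat.mul_le_mul_right _ hd
    omega
  have hbad := card_not_expander_le hd hNeq hN1
  have hnpos : 0 < n := by omega
  have hdlt : d < n := by
    have : d ≤ (d + 2) ^ 2 := by ring_nf; omega
    omega
  have hR : (0 : ℝ) < #(regularFinset (Fin n) d) := by
    exact_mod_cast (regularFinset_fin_nonempty hdlt ⟨m, hm⟩).card_pos
  have hT : (0 : ℝ) ≤ ∑' D : ℕ, (D : ℝ) * (64 / 65 : ℝ) ^ D :=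
    tsum_nonneg fun D => by positivity
  set T := ∑' D : ℕ, (D : ℝ) * (64 / 65 : ℝ) ^ D
  have hTN : 2 * T / N ≤ 16 * T / n := by
    have h8' : (n : ℝ) ≤ 8 * N := by exact_mod_cast h8
    have hn' : (0 : ℝ) < n := by exact_mod_cast hnpos
    rw [div_le_div_iff₀ (by linarith) hn']
    nlinarith
  refine le_trans ?_ (le_randomRegularProb
    fun G (hG : G.IsVertexExpander 60) => hG.spread_le)
  have : (#{G ∈ regularFinset (Fin n) d | ¬ G.IsVertexExpander 60} : ℝ) /
      #(regularFinset (Fin n) d) ≤ 2 * T / N := by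
    rw [div_le_iff₀ hR, mul_comm]
    exact hbad
  rw [div_self hR.ne']
  linarith

theorem randomRegularProb_le_one (n d : ℕ) (P : SimpleGraph (Fin n) → Prop) :
    randomRegularProb n d P ≤ 1 := by
  rw [randomRegularProb_eq]
  exact div_le_one_of_le₀ (by exact_mod_cast card_filter_le _ _) (Nat.cast_nonneg _)

end RandomRegular

theorem corollary1 :
    ∃ C : ℝ, 0 < C ∧ ∀ d : ℕ, 3 ≤ d →
      RandomRegularWhp d (fun _ G => G.spread ≤ ENNReal.ofReal C) := by
  refine ⟨spreadConst 60, spreadConst_pos 60, fun d hd => ?_⟩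
  unfold RandomRegularWhp
  have hlim : Tendsto (fun n : ℕ => 1 - (16 * ∑' D : ℕ, (D : ℝ) * (64 / 65 : ℝ) ^ D) / n)
      (atTop ⊓ 𝓟 {n : ℕ | Even (d * n)}) (𝓝 1) := by
    have := (tendsto_const_div_atTop_nhds_zero_nat
      (16 * ∑' D : ℕ, (D : ℝ) * (64 / 65 : ℝ) ^ D)).const_sub 1
    rw [sub_zero] at this
    exact this.mono_left inf_le_left
  refine tendsto_of_tendsto_of_tendsto_of_le_of_le' hlim tendsto_const_nhds ?_
    (Eventually.of_forall fun n => randomRegularProb_le_one n d _)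
  rw [eventually_inf_principal]
  filter_upwards [eventually_ge_atTop (120 * (d + 2) ^ 2)] with n hn hnd
  exact randomRegularProb_spread_ge hd hn hnd
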